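/- Let $E=(E^0,E^1,r,s)$ be a directed graph, with vertex set $E^0$, edge set $E^1$, and range and source maps $r,s\colon E^1\to E^0$. Assume that $E$ is row-finite, that is, that $s^{-1}(v)$ is finite for every $v\in E^0$. Let $M_E$ be the abelian monoid given by the generators $\{a_v\mid v\in E^0\}$ and the relations $$a_v=\sum_{\{e\in E^1\mid s(e)=v\}}a_{r(e)}\qquad\text{for every } v\in E^0 \text{ that emits at least one edge (i.e. } s^{-1}(v)\neq\emptyset).$$ Equip $M_E$ with its algebraic pre-order: $x\le y$ if and only if there is $z\in M_E$ with $y=x+z$. Then $M_E$ is unperforated: for all $a,b\in M_E$ and all positive integers $n$, if $na\le nb$, then $a\le b$. -/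

import Mathlib

universe u v

/-- A directed graph: a vertex set `V`, an edge set `Edge`, and source and range maps
(loops and multiple edges are allowed). -/
structure DirGraph (V : Type u) (Edge : Type v) where
  src : Edge → V
  rng : Edge → V

namespace DirGraph

/-- `v` emits edges if it is the source of at least one edge. -/
def Emits {V : Type u} {Edge : Type v} (E : DirGraph V Edge) (x : V) : Prop :=
  ∃ e : Edge, E.src e = x

/-- A graph is row-finite if every vertex emits only finitely many edges. -/
def RowFinite {V : Type u} {Edge : Type v} (E : DirGraph V Edge) : Prop :=
  ∀ x : V, {e : Edge | E.src e = x}.Finite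

/-- The element `∑_{s(e) = x} r(e)` of the free abelian monoid `V →₀ ℕ` on the vertices. -/
noncomputable def outSum {V : Type u} {Edge : Type v} (E : DirGraph V Edge)
    (hE : E.RowFinite) (x : V) : V →₀ ℕ :=
  ∑ e ∈ (hE x).toFinset, Finsupp.single (E.rng e) 1

/-- The defining relations of the graph monoid: `x = ∑_{s(e) = x} r(e)` for every vertex `x`
that emits edges. -/
inductive GraphRel {V : Type u} {Edge : Type v} (E : DirGraph V Edge) (hE : E.RowFinite) :
    (V →₀ ℕ) → (V →₀ ℕ) → Prop
  | of_emits (x : V) (hx : E.Emits x) : GraphRel E hE (Finsupp.single x 1) (E.outSum hE x)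

/-- The graph monoid `M_E`: the abelian monoid with generators the vertices and the relations
`GraphRel`, that is, the quotient of the free abelian monoid on the vertices by the congruence
that these relations generate. -/
abbrev graphMonoid {V : Type u} {Edge : Type v} (E : DirGraph V Edge) (hE : E.RowFinite) :
    Type u :=
  (addConGen (GraphRel E hE)).Quotient

end DirGraph

/-- The algebraic preorder of an abelian monoid: `x ≤ y` iff `y = x + z` for some `z`. -/
def AlgLE {M : Type u} [AddCommMonoid M] (x y : M) : Prop :=
  ∃ z : M, y = x + z

/-- An abelian monoid is unperforated if `n a ≤ n b` implies `a ≤ b`, for all elements `a`, `b`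
and all positive integers `n`, where `≤` is the algebraic preorder. -/
def IsUnperforated (M : Type u) [AddCommMonoid M] : Prop :=
  ∀ (a b : M) (n : ℕ), 0 < n → AlgLE (n • a) (n • b) → AlgLE a b

/-! An equality in `M_E` uses finitely many relations `v = out v`, so a finite set `S` of them
suffices. If some `v ∈ S` has no loop, substituting `out v` for `v` eliminates that relation
(`firingCon_erase_substVertex`, `firingCon_erase_le`). Once every `v ∈ S` has a loop, firing only
adds chips: `n • b = n • a + z` forces `n • a ≤ n • c` pointwise for some `c` grown from `b`. Hence
`a ≤ c`, and `c = b` in the monoid. -/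

namespace DirGraph

variable {V : Type u}

/-- The relations `x = out x`, for the vertices `x` in `S`. -/
def FiringRel (S : Finset V) (out : V → V →₀ ℕ) (x y : V →₀ ℕ) : Prop :=
  ∃ v ∈ S, x = Finsupp.single v 1 ∧ y = out v

/-- The congruence on the free abelian monoid generated by `x = out x` for `x ∈ S`. -/
noncomputable abbrev firingCon (S : Finset V) (out : V → V →₀ ℕ) : AddCon (V →₀ ℕ) :=
  addConGen (FiringRel S out)

/-- One chip at `v ∈ S` is replaced by `out v`, where `out v` contains `v`, so that the
configuration can only grow. -/
def GrowStep (S : Finset V) (out : V → V →₀ ℕ) (x y : V →₀ ℕ) : Prop :=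
  ∃ v ∈ S, Finsupp.single v 1 ≤ x ∧ y = x + (out v - Finsupp.single v 1)

/-- `x` lies pointwise below a configuration that `b` grows into. -/
def Dominates (S : Finset V) (out : V → V →₀ ℕ) (b x : V →₀ ℕ) : Prop :=
  ∃ b', Relation.ReflTransGen (GrowStep S out) b b' ∧ x ≤ b'

theorem firingCon_of_mem {S : Finset V} (out : V → V →₀ ℕ) {v : V} (hv : v ∈ S) :
    firingCon S out (Finsupp.single v 1) (out v) :=
  AddConGen.Rel.of _ _ ⟨v, hv, rfl, rfl⟩

theorem firingCon_mono {S T : Finset V} (h : S ⊆ T) (out : V → V →₀ ℕ) :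
    firingCon S out ≤ firingCon T out :=
  AddCon.addConGen_le.2 fun _ _ ⟨v, hv, hx, hy⟩ => AddConGen.Rel.of _ _ ⟨v, h hv, hx, hy⟩

section Loops

variable {S : Finset V} {out : V → V →₀ ℕ}

theorem GrowStep.firingCon (hloop : ∀ v ∈ S, Finsupp.single v 1 ≤ out v) {x y : V →₀ ℕ}
    (h : GrowStep S out x y) : firingCon S out x y := by
  obtain ⟨v, hv, hx, rfl⟩ := h
  obtain ⟨c, rfl⟩ := exists_add_of_le hx
  have := (DirGraph.firingCon S out).add (firingCon_of_mem out hv)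
    ((DirGraph.firingCon S out).refl c)
  convert this using 1
  rw [add_right_comm, add_tsub_cancel_of_le (hloop v hv)]

theorem firingCon_of_grow (hloop : ∀ v ∈ S, Finsupp.single v 1 ≤ out v) {x y : V →₀ ℕ}
    (h : Relation.ReflTransGen (GrowStep S out) x y) : firingCon S out x y := by
  induction h with
  | refl => exact (firingCon S out).refl _
  | tail _ h ih => exact (firingCon S out).trans ih (h.firingCon hloop)

/-- If `b'` lies above a configuration containing `v`, firing `v` in `b'` keeps it above the fired
one; the converse holds because `out v` contains `v`. -/
theorem dominates_iff_of_firingCon (hloop : ∀ v ∈ S, Finsupp.single v 1 ≤ out v)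
    {x y : V →₀ ℕ} (h : firingCon S out x y) (b : V →₀ ℕ) :
    Dominates S out b x ↔ Dominates S out b y := by
  -- The spectator `c` makes the claim stable under addition of relations.
  suffices H : ∀ c, Dominates S out b (x + c) ↔ Dominates S out b (y + c) by
    simpa using H 0
  replace h : AddConGen.Rel (FiringRel S out) x y := h
  induction h with
  | of x y h =>
    obtain ⟨v, hv, rfl, rfl⟩ := h
    intro c
    constructor
    · rintro ⟨b', hb, hle⟩
      refine ⟨_, hb.tail ⟨v, hv, le_self_add.trans hle, rfl⟩, ?_⟩
      calc out v + c = Finsupp.single v 1 + c + (out v - Finsupp.single v 1) := by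
            rw [add_right_comm, add_tsub_cancel_of_le (hloop v hv)]
        _ ≤ _ := by gcongr
    · rintro ⟨b', hb, hle⟩
      exact ⟨b', hb, (add_le_add_left (hloop v hv) c).trans hle⟩
  | refl x => exact fun _ => Iff.rfl
  | symm _ ih => exact fun c => (ih c).symm
  | trans _ _ ih₁ ih₂ => exact fun c => (ih₁ c).trans (ih₂ c)
  | @add w x y z _ _ ih₁ ih₂ =>
    intro c
    rw [add_assoc, ih₁, add_left_comm, ih₂, add_left_comm, add_assoc]

/-- A vertex occupied in `n • c` is occupied in `c`; firing it once in `c` adds `n` copies of the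
increment, at least the one needed. -/
theorem exists_grow_of_grow_nsmul {n : ℕ} {b b' : V →₀ ℕ}
    (h : Relation.ReflTransGen (GrowStep S out) (n • b) b') :
    ∃ c, Relation.ReflTransGen (GrowStep S out) b c ∧ b' ≤ n • c := by
  induction h with
  | refl => exact ⟨b, .refl, le_rfl⟩
  | tail _ h ih =>
    obtain ⟨c, hc, hle⟩ := ih
    obtain ⟨v, hv, hx, rfl⟩ := h
    have hvc : 1 ≤ n * c v := by simpa using (hx.trans hle) v
    have hn : 1 ≤ n := Nat.pos_of_mul_pos_right hvc
    refine ⟨_, hc.tail ⟨v, hv, ?_, rfl⟩, ?_⟩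
    · exact Finsupp.single_le_iff.2 (Nat.pos_of_mul_pos_left hvc)
    · rw [nsmul_add]
      exact add_le_add hle (le_self_nsmul zero_le (by omega))

/-- Unperforation when every vertex of `S` has a loop. -/
theorem exists_firingCon_of_nsmul_of_loops (hloop : ∀ v ∈ S, Finsupp.single v 1 ≤ out v)
    {a b z : V →₀ ℕ} {n : ℕ} (hn : 0 < n) (h : firingCon S out (n • b) (n • a + z)) :
    ∃ z', firingCon S out b (a + z') := by
  obtain ⟨b', hb, hle⟩ :=
    (dominates_iff_of_firingCon hloop h (n • b)).1 ⟨_, .refl, le_rfl⟩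
  obtain ⟨c, hc, hle'⟩ := exists_grow_of_grow_nsmul hb
  have hac : a ≤ c := fun v => Nat.le_of_mul_le_mul_left
    (by simpa using (le_self_add.trans (hle.trans hle')) v) hn
  obtain ⟨z', rfl⟩ := exists_add_of_le hac
  exact ⟨z', firingCon_of_grow hloop hc⟩

end Loops

/-- Substitution of `out v` for `v`. -/
noncomputable def substVertex [DecidableEq V] (out : V → V →₀ ℕ) (v : V) :
    (V →₀ ℕ) →+ (V →₀ ℕ) :=
  Finsupp.liftAddHom fun u =>
    multiplesHom (V →₀ ℕ) (if u = v then out v else Finsupp.single u 1)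

section Elimination

variable [DecidableEq V] (out : V → V →₀ ℕ) (v : V)

theorem substVertex_single (u : V) :
    substVertex out v (Finsupp.single u 1) = if u = v then out v else Finsupp.single u 1 := by
  simp [substVertex]

theorem substVertex_of_apply_eq_zero {x : V →₀ ℕ} (hx : x v = 0) :
    substVertex out v x = x := by
  rw [substVertex, Finsupp.liftAddHom_apply]
  conv_rhs => rw [← Finsupp.sum_single x]
  refine Finsupp.sum_congr fun u hu => ?_
  have : u ≠ v := by rintro rfl; simp [hx] at hu
  simp [this]

theorem firingCon_substVertex {S : Finset V} (hv : v ∈ S) (x : V →₀ ℕ) :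
    firingCon S out x (substVertex out v x) := by
  induction x using Finsupp.induction_linear with
  | zero => simpa using (firingCon S out).refl 0
  | add f g hf hg => rw [map_add (substVertex out v)]; exact (firingCon S out).add hf hg
  | single u n =>
    have : Finsupp.single u n = n • Finsupp.single u 1 := by simp
    rw [this, map_nsmul (substVertex out v)]
    refine (firingCon S out).nsmul n ?_
    rw [substVertex_single]
    split_ifs with h
    · rw [h]; exact firingCon_of_mem out hv
    · exact (firingCon S out).refl _

theorem firingCon_erase_substVertex {S : Finset V} (hout : out v v = 0) {x y : V →₀ ℕ}
    (h : firingCon S out x y) :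
    firingCon (S.erase v) (fun u => substVertex out v (out u))
      (substVertex out v x) (substVertex out v y) := by
  set C := firingCon (S.erase v) (fun u => substVertex out v (out u))
  suffices H : firingCon S out ≤ C.comap (substVertex out v) (map_add _) from H h
  refine AddCon.addConGen_le.2 ?_
  rintro _ _ ⟨u, hu, rfl, rfl⟩
  rw [AddCon.comap_rel, substVertex_single]
  split_ifs with huv
  · rw [huv, substVertex_of_apply_eq_zero out v hout]
    exact C.refl _
  · exact firingCon_of_mem (fun u => substVertex out v (out u)) (Finset.mem_erase.2 ⟨huv, hu⟩)

theorem firingCon_erase_le {S : Finset V} (hv : v ∈ S) :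
    firingCon (S.erase v) (fun u => substVertex out v (out u)) ≤ firingCon S out := by
  refine AddCon.addConGen_le.2 ?_
  rintro _ _ ⟨u, hu, rfl, rfl⟩
  exact (firingCon S out).trans (firingCon_of_mem out (Finset.mem_of_mem_erase hu))
    (firingCon_substVertex out v hv _)

end Elimination

/-- Unperforation for finitely many relations. -/
theorem exists_firingCon_of_nsmul (S : Finset V) (out : V → V →₀ ℕ) {a b z : V →₀ ℕ} {n : ℕ}
    (hn : 0 < n) (h : firingCon S out (n • b) (n • a + z)) :
    ∃ z', firingCon S out b (a + z') := by
  classical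
  -- `out` must vary, since eliminating a vertex rewrites the remaining relations.
  induction hS : S.card generalizing S out a b z with
  | zero =>
    refine exists_firingCon_of_nsmul_of_loops ?_ hn h
    simp [Finset.card_eq_zero.1 hS]
  | succ k ih =>
    by_cases hloop : ∀ v ∈ S, Finsupp.single v 1 ≤ out v
    · exact exists_firingCon_of_nsmul_of_loops hloop hn h
    push Not at hloop
    obtain ⟨v, hv, hle⟩ := hloop
    have hout : out v v = 0 := by
      rw [Finsupp.single_le_iff] at hle
      omega
    have h' := firingCon_erase_substVertex out v hout h
    rw [map_add (substVertex out v), map_nsmul (substVertex out v),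
      map_nsmul (substVertex out v)] at h'
    obtain ⟨z', hz'⟩ := ih _ _ h' (by rw [Finset.card_erase_of_mem hv, hS]; rfl)
    refine ⟨z', ?_⟩
    refine AddCon.trans _ (firingCon_substVertex out v hv b) ?_
    refine AddCon.trans _ (firingCon_erase_le out v hv hz') ?_
    exact AddCon.add _ (AddCon.symm _ (firingCon_substVertex out v hv a)) (AddCon.refl _ z')

variable {Edge : Type v}

theorem firingCon_le_addConGen (E : DirGraph V Edge) (hE : E.RowFinite) {S : Finset V}
    (hS : ∀ v ∈ S, E.Emits v) : firingCon S (E.outSum hE) ≤ addConGen (GraphRel E hE) := by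
  refine AddCon.addConGen_le.2 ?_
  rintro _ _ ⟨v, hv, rfl, rfl⟩
  exact AddConGen.Rel.of _ _ (.of_emits v (hS v hv))

/-- An equality in the graph monoid uses only finitely many of the relations. -/
theorem exists_firingCon_of_addConGen (E : DirGraph V Edge) (hE : E.RowFinite) {x y : V →₀ ℕ}
    (h : addConGen (GraphRel E hE) x y) :
    ∃ S : Finset V, (∀ v ∈ S, E.Emits v) ∧ firingCon S (E.outSum hE) x y := by
  classical
  have hunion {S T : Finset V} (hS : ∀ v ∈ S, E.Emits v) (hT : ∀ v ∈ T, E.Emits v) :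
      ∀ v ∈ S ∪ T, E.Emits v := fun v hv => (Finset.mem_union.1 hv).elim (hS v) (hT v)
  replace h : AddConGen.Rel (GraphRel E hE) x y := h
  induction h with
  | of x y h =>
    obtain ⟨v, hv⟩ := h
    exact ⟨{v}, by simpa using hv, firingCon_of_mem _ (Finset.mem_singleton_self v)⟩
  | refl x => exact ⟨∅, by simp, AddCon.refl _ x⟩
  | symm _ ih =>
    obtain ⟨S, hS, h⟩ := ih
    exact ⟨S, hS, AddCon.symm _ h⟩
  | trans _ _ ih₁ ih₂ =>
    obtain ⟨S, hS, h⟩ := ih₁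
    obtain ⟨T, hT, h'⟩ := ih₂
    exact ⟨S ∪ T, hunion hS hT, AddCon.trans _
      (firingCon_mono Finset.subset_union_left _ h)
      (firingCon_mono Finset.subset_union_right _ h')⟩
  | add _ _ ih₁ ih₂ =>
    obtain ⟨S, hS, h⟩ := ih₁
    obtain ⟨T, hT, h'⟩ := ih₂
    exact ⟨S ∪ T, hunion hS hT, AddCon.add _
      (firingCon_mono Finset.subset_union_left _ h)
      (firingCon_mono Finset.subset_union_right _ h')⟩

end DirGraph

open DirGraph in
theorem proposition6p4 {V : Type u} {Edge : Type v} (E : DirGraph V Edge) (hE : E.RowFinite) :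
    IsUnperforated (E.graphMonoid hE) := by
  intro a b n hn ⟨z, hz⟩
  induction a using AddCon.induction_on with | _ a
  induction b using AddCon.induction_on with | _ b
  induction z using AddCon.induction_on with | _ z
  have h : addConGen (GraphRel E hE) (n • b) (n • a + z) := (AddCon.eq _).1 hz
  obtain ⟨S, hS, h⟩ := exists_firingCon_of_addConGen E hE h
  obtain ⟨z', hz'⟩ := exists_firingCon_of_nsmul S _ hn h
  exact ⟨(z' : (addConGen (GraphRel E hE)).Quotient),
    (AddCon.eq _).2 (firingCon_le_addConGen E hE hS hz')⟩
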